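/- Let $S=\{q_x,\rho_x\}_{x=1}^n$ be an ensemble of $n>2$ qubit states ($\rho_x$ a density operator on $\mathbb{C}^2$, $q_x\ge 0$, $\sum_x q_x=1$). A POVM $M=\{M_x\}_{x=1}^n$ ($M_x\ge 0$, $\sum_x M_x=\mathbb{I}$) is called optimal for $S$ if it maximizes the guessing probability $\sum_x q_x\,\mathrm{tr}[M_x\rho_x]$ over all such POVMs. Assume that always guessing one fixed state without measuring is not optimal for $S$. Let $M$ be an optimal POVM for $S$ that identifies all states, i.e. $M_x\neq 0$ for all $x$, and assume that at least three of the operators $M_x$ are pairwise non-proportional (under the other assumptions this says exactly that $M$ is not merely a subdivision of a projective measurement $\{P,\mathbb{I}-P\}$ with $P$ a rank-one projector). Let $U$ be a $2\times 2$ unitary matrix such that $\mathcal{E}_U(\rho)=U\rho\,U^\dagger$ is not the identity map. Then $\mathcal{E}_U$ is not optimal measurement preserving for $S$ and $M$: the POVM $M$ is not optimal for the ensemble $\{q_x,U\rho_xU^\dagger\}_{x=1}^n$. -/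

import Mathlib

open scoped Matrix Kronecker ComplexOrder

noncomputable section

/-- Operators on the qubit Hilbert space. -/
abbrev QubitOp : Type := Matrix (Fin 2) (Fin 2) ℂ

/-- An ensemble of `n` qubit states: state `ρ x` appears with a priori probability `q x`. -/
structure QubitEnsemble (n : ℕ) where
  q : Fin n → ℝ
  ρ : Fin n → QubitOp
  q_nonneg : ∀ x, 0 ≤ q x
  q_sum : ∑ x, q x = 1
  ρ_posSemidef : ∀ x, (ρ x).PosSemidef
  ρ_trace : ∀ x, (ρ x).trace = 1

/-- A positive operator-valued measure with `n` outcomes on a qubit. -/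
structure QubitPOVM (n : ℕ) where
  elem : Fin n → QubitOp
  posSemidef : ∀ x, (elem x).PosSemidef
  sum_eq_one : ∑ x, elem x = 1

/-- The POVM `M x = δ_{jx} 1`: no measurement is performed and `j` is always guessed. -/
def QubitPOVM.alwaysGuess {n : ℕ} (j : Fin n) : QubitPOVM n where
  elem := fun x => if x = j then 1 else 0
  posSemidef := by
    intro x
    split_ifs
    · exact Matrix.PosSemidef.one
    · exact Matrix.PosSemidef.zero
  sum_eq_one := by simp

/-- All states are identified by `M`: no element of the POVM is the null operator. -/
def QubitPOVM.IdentifiesAll {n : ℕ} (M : QubitPOVM n) : Prop :=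
  ∀ x, M.elem x ≠ 0

/-- The average probability of guessing correctly, `∑ x, q x * tr (M x * ρ x)`
(the traces are real, both factors being positive semidefinite). -/
def QubitEnsemble.successProb {n : ℕ} (S : QubitEnsemble n) (M : QubitPOVM n) : ℝ :=
  ∑ x, S.q x * ((M.elem x * S.ρ x).trace).re

/-- `M` is an optimal (minimum-error) measurement for the ensemble `S`. -/
def QubitEnsemble.IsOptimal {n : ℕ} (S : QubitEnsemble n) (M : QubitPOVM n) : Prop :=
  ∀ M' : QubitPOVM n, S.successProb M' ≤ S.successProb M

/-- `id ⊗ N` on operators of `ℂ^k ⊗ ℂ^2`: apply `N` to each of the `k × k` blocks. -/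
def ampliation (N : QubitOp →ₗ[ℂ] QubitOp) (k : ℕ)
    (X : Matrix (Fin k × Fin 2) (Fin k × Fin 2) ℂ) :
    Matrix (Fin k × Fin 2) (Fin k × Fin 2) ℂ :=
  Matrix.of fun a b => N (Matrix.of fun i j => X (a.1, i) (b.1, j)) a.2 b.2

/-- A qubit channel: a completely positive, trace preserving linear map. -/
structure QubitChannel where
  toLin : QubitOp →ₗ[ℂ] QubitOp
  completelyPositive : ∀ (k : ℕ) (X : Matrix (Fin k × Fin 2) (Fin k × Fin 2) ℂ),
    X.PosSemidef → (ampliation toLin k X).PosSemidef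
  tracePreserving : ∀ A : QubitOp, (toLin A).trace = A.trace

theorem QubitChannel.posSemidef (N : QubitChannel) {A : QubitOp} (hA : A.PosSemidef) :
    (N.toLin A).PosSemidef := by
  have h1 := N.completelyPositive 1 (A.submatrix Prod.snd Prod.snd) (hA.submatrix _)
  have h2 := h1.submatrix (fun i : Fin 2 => ((0 : Fin 1), i))
  exact h2

/-- The ensemble after each state has been sent through the channel. -/
def QubitEnsemble.through {n : ℕ} (S : QubitEnsemble n) (N : QubitChannel) :
    QubitEnsemble n where
  q := S.q
  ρ := fun x => N.toLin (S.ρ x)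
  q_nonneg := S.q_nonneg
  q_sum := S.q_sum
  ρ_posSemidef := fun x => N.posSemidef (S.ρ_posSemidef x)
  ρ_trace := fun x => (N.tracePreserving _).trans (S.ρ_trace x)

/-- `N` is optimal measurement preserving for the ensemble `S` and the measurement `M`:
`M` solves the discrimination problem before and after the use of the channel. -/
def QubitChannel.IsOMP {n : ℕ} (N : QubitChannel) (S : QubitEnsemble n)
    (M : QubitPOVM n) : Prop :=
  S.IsOptimal M ∧ (S.through N).IsOptimal M

/-- The linear map `A ↦ U A U†`. -/
def conjugation (U : QubitOp) : QubitOp →ₗ[ℂ] QubitOp where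
  toFun := fun A => U * A * Uᴴ
  map_add' := by intro A B; simp [Matrix.mul_add, Matrix.add_mul]
  map_smul' := by intro c A; simp

/-- The unitary channel `A ↦ U A U†`. -/
def unitaryChannel (U : Matrix.unitaryGroup (Fin 2) ℂ) : QubitChannel where
  toLin := conjugation (U : QubitOp)
  completelyPositive := by
    intro k X hX
    have h := hX.mul_mul_conjTranspose_same ((1 : Matrix (Fin k) (Fin k) ℂ) ⊗ₖ (U : QubitOp))
    convert h using 1
    ext ⟨a, i⟩ ⟨b, j⟩
    simp [ampliation, conjugation, Matrix.mul_apply, Fintype.sum_prod_type, Matrix.one_apply,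
      Finset.sum_ite_eq, apply_ite (starRingEnd ℂ)]
  tracePreserving := by
    intro A
    have hU : (U : QubitOp)ᴴ * (U : QubitOp) = 1 := Matrix.mem_unitaryGroup_iff'.mp U.2
    change ((U : QubitOp) * A * (U : QubitOp)ᴴ).trace = A.trace
    rw [Matrix.trace_mul_comm, ← Matrix.mul_assoc, hU, Matrix.one_mul]

end

open Matrix

section PosSemidefProducts

open scoped MatrixOrder

variable {m : Type*} [Fintype m] {A B : Matrix m m ℂ}

/-! Optimality supplies a dual operator `G` with `G - q x • ρ x` positive and annihilating `M x`
(`exists_dual`). As no blind guess is optimal, these slacks are nonzero; in dimension two this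
forces `M x = m x • P x` with `P x` a rank-one projector and slack `a x • (1 - P x)`, `a x > 0`. If
`M` stays optimal after the rotation, the new slacks are `b x • (1 - P x)` with `b x ≥ 0`.
Conjugating the old slacks by `U` and subtracting the new ones cancels the states, so `a x • U P x
U† - b x • P x` is one operator `C` for all `x`.

Its trace makes `a x - b x` a constant `d`. If `d = 0`, averaging against `∑ m x • P x = 1` gives `C
= 0`; then the nonscalar `U` commutes with every `P x`, which leaves only a projector and its
complement. If `d ≠ 0`, `tr (C U)` and `tr (C²)` make `a` and `b` constant, and comparing
Hilbert–Schmidt norms makes all `P x` equal. Neither case allows three directions. -/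

theorem Matrix.PosSemidef.trace_mul_nonneg (hA : A.PosSemidef) (hB : B.PosSemidef) :
    0 ≤ (A * B).trace := by
  classical
  obtain ⟨C, rfl⟩ := CStarAlgebra.nonneg_iff_eq_star_mul_self.mp hB.nonneg
  rw [← Matrix.mul_assoc, Matrix.trace_mul_comm, ← Matrix.mul_assoc]
  exact (hA.mul_mul_conjTranspose_same C).trace_nonneg

theorem Matrix.PosSemidef.mul_eq_zero_of_trace_mul_eq_zero (hA : A.PosSemidef)
    (hB : B.PosSemidef) (h : (A * B).trace = 0) : A * B = 0 := by
  classical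
  obtain ⟨C, rfl⟩ := CStarAlgebra.nonneg_iff_eq_star_mul_self.mp hB.nonneg
  obtain ⟨D, rfl⟩ := CStarAlgebra.nonneg_iff_eq_star_mul_self.mp hA.nonneg
  simp only [star_eq_conjTranspose] at h ⊢
  have h0 : ((D * Cᴴ)ᴴ * (D * Cᴴ)).trace = 0 := by
    rw [← h, conjTranspose_mul, conjTranspose_conjTranspose, Matrix.mul_assoc C,
      Matrix.trace_mul_comm C]
    simp only [Matrix.mul_assoc]
  have h1 : D * Cᴴ = 0 := trace_conjTranspose_mul_self_eq_zero_iff.mp h0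
  rw [Matrix.mul_assoc, ← Matrix.mul_assoc D, h1]
  simp

end PosSemidefProducts

theorem Matrix.IsHermitian.eq_zero_of_trace_mul_self_eq_zero {D : QubitOp}
    (hD : D.IsHermitian) (h : (D * D).trace = 0) : D = 0 := by
  refine trace_conjTranspose_mul_self_eq_zero_iff.mp (?_ : (Dᴴ * D).trace = 0)
  rwa [hD.eq]

/-! ### Optimality conditions for a measurement -/

theorem QubitEnsemble.successProb_eq {n : ℕ} (S : QubitEnsemble n) (M : QubitPOVM n) :
    S.successProb M = ∑ x, ((M.elem x * ((S.q x : ℂ) • S.ρ x)).trace).re := by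
  simp [QubitEnsemble.successProb, Matrix.trace_smul]

theorem nonpos_of_forall_small_quadratic {l c r : ℝ} (hr : 0 < r)
    (h : ∀ ε : ℝ, 0 ≤ ε → ε ≤ r → ε * l + ε ^ 2 * c ≤ 0) : l ≤ 0 := by
  by_contra! hl
  have hc : 0 < |c| + 1 := by positivity
  obtain ⟨ε, hε, h1, h2⟩ : ∃ ε : ℝ, 0 < ε ∧ ε ≤ r ∧ ε * (|c| + 1) ≤ l / 2 :=
    ⟨min r (l / 2 / (|c| + 1)), by positivity, min_le_left _ _, by
      rw [← le_div_iff₀ hc]; exact min_le_right _ _⟩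
  have h3 := h ε hε.le h1
  have h4 : l + ε * c ≤ 0 := by
    by_contra! h5
    nlinarith [mul_pos hε h5]
  nlinarith [neg_abs_le c]

/-- Move weight `ε` of the measurement towards the rank-one operator `v v†` on outcome `j`. -/
def QubitPOVM.perturb {n : ℕ} (M : QubitPOVM n) (j : Fin n) (v : Fin 2 → ℂ) (ε : ℝ)
    (h0 : 0 ≤ ε) (h2 : ε * (v ⬝ᵥ star v).re ≤ 2) : QubitPOVM n where
  elem := fun x => (1 - (ε : ℂ) • vecMulVec v (star v)) * M.elem x *
      (1 - (ε : ℂ) • vecMulVec v (star v)) +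
    if x = j then ((ε * (2 - ε * (v ⬝ᵥ star v).re) : ℝ) : ℂ) • vecMulVec v (star v) else 0
  posSemidef := by
    intro x
    refine Matrix.PosSemidef.add ?_ ?_
    · have hE : (1 - (ε : ℂ) • vecMulVec v (star v))ᴴ = 1 - (ε : ℂ) • vecMulVec v (star v) := by
        rw [conjTranspose_sub, conjTranspose_smul, conjTranspose_vecMulVec]
        simp
      have h := (M.posSemidef x).mul_mul_conjTranspose_same (1 - (ε : ℂ) • vecMulVec v (star v))
      rwa [hE] at h
    · split_ifs
      · refine (posSemidef_vecMulVec_self_star v).smul ?_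
        exact Complex.zero_le_real.mpr (mul_nonneg h0 (by linarith))
      · exact Matrix.PosSemidef.zero
  sum_eq_one := by
    have hs : ((v ⬝ᵥ star v).re : ℂ) = v ⬝ᵥ star v := by
      have : 0 ≤ v ⬝ᵥ star v := dotProduct_self_star_nonneg v
      exact (Complex.eq_re_of_ofReal_le (r := 0) (by simpa using this)).symm
    rw [Finset.sum_add_distrib, ← Finset.sum_mul, ← Finset.mul_sum, M.sum_eq_one]
    have hE : vecMulVec v (star v) * vecMulVec v (star v) =
        (v ⬝ᵥ star v) • vecMulVec v (star v) := by
      rw [vecMulVec_mul_vecMulVec, dotProduct_comm]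
      ext i j
      simp [vecMulVec_apply]
      ring
    simp only [mul_one, Finset.sum_ite_eq', Finset.mem_univ, if_true]
    push_cast
    rw [hs]
    simp only [sub_mul, mul_sub, mul_one, one_mul, smul_mul_assoc, mul_smul_comm, hE]
    module

/-- The dual operator is the Hermitian part of `∑ M x * W x`, with `W x = q x • ρ x`. Its positivity
conditions are the first-order conditions for the perturbations `perturb j v ε`, so no abstract
duality is needed. -/
theorem QubitEnsemble.IsOptimal.exists_dual {n : ℕ} {S : QubitEnsemble n} {M : QubitPOVM n}
    (hM : S.IsOptimal M) :
    ∃ G : QubitOp, (∀ j, (G - (S.q j : ℂ) • S.ρ j).PosSemidef) ∧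
      (∀ j, (G - (S.q j : ℂ) • S.ρ j) * M.elem j = 0) ∧ G.trace.re = S.successProb M := by
  set W : Fin n → QubitOp := fun j => (S.q j : ℂ) • S.ρ j with hW
  have hWpsd : ∀ j, (W j).PosSemidef := fun j =>
    (S.ρ_posSemidef j).smul (Complex.zero_le_real.mpr (S.q_nonneg j))
  set K : QubitOp := ∑ x, M.elem x * W x with hK
  set G : QubitOp := (1 / 2 : ℂ) • (K + Kᴴ) with hG
  have hGH : G.IsHermitian := by
    rw [IsHermitian, hG, conjTranspose_smul, conjTranspose_add, conjTranspose_conjTranspose,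
      add_comm]
    simp
  have hretr : ∀ A : QubitOp, Aᴴ.trace.re = A.trace.re := fun A => by
    rw [trace_conjTranspose]; simp
  have hGE : ∀ E : QubitOp, E.IsHermitian → (E * G).trace.re = (E * K).trace.re := by
    intro E hE
    have h1 : (E * Kᴴ).trace.re = (E * K).trace.re := by
      rw [← hretr (E * K), conjTranspose_mul, hE.eq, trace_mul_comm]
    have h2 : (E * G).trace = (1 / 2 : ℝ) * ((E * K).trace + (E * Kᴴ).trace) := by
      rw [hG, mul_smul_comm, mul_add, trace_smul, trace_add, smul_eq_mul]
      norm_num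
    rw [h2, Complex.re_ofReal_mul, Complex.add_re, h1]
    ring
  have hSM : S.successProb M = K.trace.re := by
    rw [S.successProb_eq, hK, trace_sum, Complex.re_sum]
  have hGtr : G.trace.re = S.successProb M := by
    have := hGE 1 isHermitian_one
    rwa [one_mul, one_mul, ← hSM] at this
  have hpsd : ∀ j, (G - W j).PosSemidef := by
    intro j
    refine posSemidef_iff_dotProduct_mulVec.mpr ⟨hGH.sub (hWpsd j).1, fun v => ?_⟩
    set E : QubitOp := vecMulVec v (star v) with hE
    have hEH : E.IsHermitian := (posSemidef_vecMulVec_self_star v).1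
    set s : ℝ := (v ⬝ᵥ star v).re with hs
    have hs0 : 0 ≤ s := (Complex.le_def.mp (dotProduct_self_star_nonneg v)).1
    have hform : ∀ A : QubitOp, star v ⬝ᵥ (A *ᵥ v) = (E * A).trace := by
      intro A
      rw [trace_mul_comm, hE, mul_vecMulVec, trace_vecMulVec, dotProduct_comm]
    have hreal : (star v ⬝ᵥ ((G - W j) *ᵥ v)).im = 0 :=
      (hGH.sub (hWpsd j).1).im_star_dotProduct_mulVec_self v
    have hmain : 2 * ((E * W j).trace.re - (E * K).trace.re) ≤ 0 := by
      -- The bound `2 / (s + 1)` ensures `ε * s ≤ 2` even when `v = 0`.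
      refine nonpos_of_forall_small_quadratic (r := 2 / (s + 1))
        (c := (∑ x, (E * M.elem x * E * W x).trace.re) - s * (E * W j).trace.re)
        (by positivity) fun ε hε hεr => ?_
      have hεs : ε * s ≤ 2 := by
        rw [le_div_iff₀ (by positivity)] at hεr
        nlinarith
      have hopt := hM (M.perturb j v ε hε hεs)
      have hx : ∀ x, (((M.perturb j v ε hε hεs).elem x * W x).trace).re =
          (M.elem x * W x).trace.re - 2 * ε * (E * (M.elem x * W x)).trace.re
            + ε ^ 2 * (E * M.elem x * E * W x).trace.re
            + if x = j then ε * (2 - ε * s) * (E * W j).trace.re else 0 := by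
        intro x
        have h1 : (M.elem x * E * W x).trace.re = (E * (M.elem x * W x)).trace.re := by
          rw [← hretr (M.elem x * E * W x), conjTranspose_mul, conjTranspose_mul, hEH.eq,
            (hWpsd x).1.eq, (M.posSemidef x).1.eq, trace_mul_comm, mul_assoc]
        have h2 : (1 - (ε : ℂ) • E) * M.elem x * (1 - (ε : ℂ) • E) * W x =
            M.elem x * W x - (ε : ℂ) • (E * (M.elem x * W x) + M.elem x * E * W x)
              + ((ε ^ 2 : ℝ) : ℂ) • (E * M.elem x * E * W x) := by
          push_cast
          simp only [sub_mul, mul_sub, mul_one, one_mul, smul_mul_assoc, mul_smul_comm, mul_assoc]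
          module
        have h3 : ((if x = j then ((ε * (2 - ε * s) : ℝ) : ℂ) • E else 0) * W x).trace.re =
            if x = j then ε * (2 - ε * s) * (E * W j).trace.re else 0 := by
          split_ifs with hxj
          · rw [hxj, smul_mul_assoc, trace_smul, smul_eq_mul, Complex.re_ofReal_mul]
          · simp
        change (((1 - (ε : ℂ) • E) * M.elem x * (1 - (ε : ℂ) • E) +
          if x = j then ((ε * (2 - ε * s) : ℝ) : ℂ) • E else 0) * W x).trace.re = _
        rw [add_mul, trace_add, Complex.add_re, h3, h2, trace_add, trace_sub, trace_smul,
          trace_smul, trace_add, Complex.add_re, Complex.sub_re, smul_eq_mul, smul_eq_mul,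
          Complex.re_ofReal_mul, Complex.re_ofReal_mul, Complex.add_re, h1]
        ring
      rw [S.successProb_eq, S.successProb_eq] at hopt
      change ∑ x, (((M.perturb j v ε hε hεs).elem x * W x).trace).re ≤
        ∑ x, (M.elem x * W x).trace.re at hopt
      simp only [hx] at hopt
      have hEK : (E * K).trace.re = ∑ x, (E * (M.elem x * W x)).trace.re := by
        rw [hK, Finset.mul_sum, trace_sum, Complex.re_sum]
      rw [Finset.sum_add_distrib, Finset.sum_add_distrib, Finset.sum_sub_distrib,
        ← Finset.mul_sum, ← Finset.mul_sum, ← hEK] at hopt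
      simp only [Finset.sum_ite_eq', Finset.mem_univ, if_true] at hopt
      linarith
    refine Complex.le_def.mpr ⟨?_, hreal.symm⟩
    rw [hform, mul_sub, trace_sub, Complex.sub_re, hGE E hEH]
    simp only [Complex.zero_re]
    linarith
  refine ⟨G, hpsd, fun j => ?_, hGtr⟩
  refine (hpsd j).mul_eq_zero_of_trace_mul_eq_zero (M.posSemidef j) ?_
  have hnn : ∀ x, 0 ≤ ((G - W x) * M.elem x).trace := fun x =>
    (hpsd x).trace_mul_nonneg (M.posSemidef x)
  -- Zero duality gap: nonnegative terms with sum zero all vanish.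
  have hsum : ∑ x, ((G - W x) * M.elem x).trace.re = 0 := by
    have h1 : ∑ x, (G - W x) * M.elem x = G - ∑ x, W x * M.elem x := by
      simp only [sub_mul, Finset.sum_sub_distrib, ← Finset.mul_sum, M.sum_eq_one, mul_one]
    rw [← Complex.re_sum, ← trace_sum, h1, trace_sub, Complex.sub_re, hGtr, hSM, hK, trace_sum,
      trace_sum, Complex.re_sum, Complex.re_sum]
    rw [Finset.sum_congr rfl fun x _ => congrArg Complex.re (trace_mul_comm (W x) (M.elem x)),
      sub_self]
  have hz := (Finset.sum_eq_zero_iff_of_nonneg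
    (fun x _ => (Complex.le_def.mp (hnn x)).1)).mp hsum j (Finset.mem_univ j)
  exact Complex.ext hz (Complex.le_def.mp (hnn j)).2.symm

/-! ### Rank-one projectors on a qubit -/

/-- `P` is a rank-one orthogonal projector on the qubit space. -/
structure IsPureProj (P : QubitOp) : Prop where
  isHermitian : P.IsHermitian
  mul_self : P * P = P
  trace_eq : P.trace = 1

theorem IsPureProj.det_eq_zero {P : QubitOp} (hP : IsPureProj P) : P.det = 0 := by
  have h := congrFun (congrFun hP.mul_self 0) 0
  have ht := hP.trace_eq
  simp only [mul_apply, Fin.sum_univ_two, trace_fin_two] at h ht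
  rw [det_fin_two]
  linear_combination P 0 0 * ht - h

theorem IsPureProj.one_sub {P : QubitOp} (hP : IsPureProj P) : IsPureProj (1 - P) where
  isHermitian := isHermitian_one.sub hP.isHermitian
  mul_self := by simp [sub_mul, mul_sub, hP.mul_self]
  trace_eq := by
    rw [trace_sub, hP.trace_eq]
    norm_num

/-- A singular 2×2 matrix is `u vᵀ`, and `u vᵀ X u vᵀ = (vᵀ X u) u vᵀ`. -/
theorem mul_mul_self_of_det_eq_zero {R : QubitOp} (hR : R.det = 0) (X : QubitOp) :
    R * X * R = (X * R).trace • R := by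
  rw [det_fin_two] at hR
  ext i j
  fin_cases i <;> fin_cases j <;>
    simp [mul_apply, Fin.sum_univ_two, trace_fin_two]
  · linear_combination -(X 1 1) * hR
  · linear_combination (X 0 1) * hR
  · linear_combination (X 1 0) * hR
  · linear_combination -(X 0 0) * hR

theorem IsPureProj.mul_mul {P : QubitOp} (hP : IsPureProj P) (X : QubitOp) :
    P * X * P = (X * P).trace • P :=
  mul_mul_self_of_det_eq_zero hP.det_eq_zero X

theorem Matrix.det_eq_zero_of_mul_eq_zero_left {A B : QubitOp} (h : A * B = 0) (hB : B ≠ 0) :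
    A.det = 0 := by
  by_contra hA
  have h1 : IsUnit A := (isUnit_iff_isUnit_det A).mpr (isUnit_iff_ne_zero.mpr hA)
  exact hB (h1.mul_right_eq_zero.mp h)

theorem mul_self_of_det_eq_zero {B : QubitOp} (hB : B.det = 0) : B * B = B.trace • B := by
  simpa using mul_mul_self_of_det_eq_zero hB 1

theorem Matrix.PosSemidef.trace_eq_re {A : QubitOp} (hA : A.PosSemidef) :
    A.trace = (A.trace.re : ℂ) :=
  Complex.ext rfl (by simpa using (Complex.le_def.mp hA.trace_nonneg).2.symm)

theorem Matrix.PosSemidef.trace_re_nonneg {A : QubitOp} (hA : A.PosSemidef) :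
    0 ≤ A.trace.re :=
  (Complex.le_def.mp hA.trace_nonneg).1

theorem Matrix.PosSemidef.trace_re_pos {A : QubitOp} (hA : A.PosSemidef) (h0 : A ≠ 0) :
    0 < A.trace.re := by
  refine lt_of_le_of_ne hA.trace_re_nonneg fun h => h0 (hA.trace_eq_zero_iff.mp ?_)
  rw [hA.trace_eq_re, ← h, Complex.ofReal_zero]

theorem Matrix.PosSemidef.exists_isPureProj {B : QubitOp} (hB : B.PosSemidef) (h0 : B ≠ 0)
    (hdet : B.det = 0) : ∃ P, IsPureProj P ∧ B = (B.trace.re : ℂ) • P := by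
  have hpos := hB.trace_re_pos h0
  have hne : (B.trace.re : ℂ) ≠ 0 := Complex.ofReal_ne_zero.mpr hpos.ne'
  have hBB := mul_self_of_det_eq_zero hdet
  rw [hB.trace_eq_re] at hBB
  refine ⟨(B.trace.re : ℂ)⁻¹ • B, ⟨?_, ?_, ?_⟩, ?_⟩
  · rw [IsHermitian, conjTranspose_smul, hB.1.eq, ← Complex.ofReal_inv]
    simp
  · rw [smul_mul_assoc, mul_smul_comm, hBB, smul_smul (_⁻¹) (B.trace.re : ℂ),
      inv_mul_cancel₀ hne, one_smul]
  · rw [trace_smul, smul_eq_mul]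
    nth_rw 2 [hB.trace_eq_re]
    exact inv_mul_cancel₀ hne
  · rw [smul_smul, mul_inv_cancel₀ hne, one_smul]

theorem IsPureProj.eq_smul_one_sub {P A : QubitOp} (hP : IsPureProj P) (hA : A.PosSemidef)
    (h : A * P = 0) : A = (A.trace.re : ℂ) • (1 - P) := by
  have h' : P * A = 0 := by
    simpa [conjTranspose_mul, hP.isHermitian.eq, hA.1.eq] using congrArg conjTranspose h
  have h1 := hP.one_sub.mul_mul A
  simp only [sub_mul, mul_sub, one_mul, mul_one, h, h', sub_zero] at h1
  rw [← hA.trace_eq_re]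
  rw [← h1]

theorem IsPureProj.exists_of_commute {P U : QubitOp} (hP : IsPureProj P) (h : Commute U P) :
    ∃ c : ℂ, U - (U.trace / 2) • (1 : QubitOp) = c • (2 • P - 1) := by
  have h1 : U * P = (U * P).trace • P := by
    rw [← hP.mul_mul U, ← h.eq, mul_assoc, hP.mul_self]
  have h2 : U * (1 - P) = (U * (1 - P)).trace • (1 - P) := by
    have hc : Commute U (1 - P) := (Commute.one_right U).sub_right h
    rw [← hP.one_sub.mul_mul U, ← hc.eq, mul_assoc, hP.one_sub.mul_self]
  set s := (U * P).trace
  set r := (U * (1 - P)).trace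
  have h3 : U = s • P + r • (1 - P) := by
    rw [← h1, ← h2, ← mul_add]
    simp
  have h4 : U.trace = s + r := by
    rw [h3, trace_add, trace_smul, trace_smul, hP.trace_eq, hP.one_sub.trace_eq]
    simp
  refine ⟨(s - r) / 2, ?_⟩
  rw [h4, h3]
  module

/-- The traceless part of `U` is a nonzero multiple of both reflections `2P - 1` and `2Q - 1`. Both
square to one, so they agree up to sign. -/
theorem IsPureProj.eq_or_eq_one_sub {P Q U : QubitOp} (hP : IsPureProj P) (hQ : IsPureProj Q)
    (hPU : Commute U P) (hQU : Commute U Q) (hU : ∀ c : ℂ, U ≠ c • 1) : P = Q ∨ P = 1 - Q := by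
  obtain ⟨c, hc⟩ := hP.exists_of_commute hPU
  obtain ⟨d, hd⟩ := hQ.exists_of_commute hQU
  have hc0 : c ≠ 0 := by
    rintro rfl
    rw [zero_smul, sub_eq_zero] at hc
    exact hU _ hc
  have hsq : ∀ {R : QubitOp}, IsPureProj R → ((2 : ℕ) • R - 1) * ((2 : ℕ) • R - 1) = 1 := by
    intro R hR
    simp only [sub_mul, mul_sub, mul_one, one_mul, smul_mul_assoc, mul_smul_comm, hR.mul_self]
    module
  have h1 : c • ((2 : ℕ) • P - 1) = d • ((2 : ℕ) • Q - 1) := hc.symm.trans hd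
  have h2 : c * c = d * d := by
    have h3 := congrArg (fun X => (X * X) 0 0) h1
    simpa only [smul_mul_assoc, mul_smul_comm, hsq hP, hsq hQ, Matrix.smul_apply, one_apply_eq,
      smul_eq_mul, mul_one] using h3
  have key : ∀ X : QubitOp, c • ((2 : ℕ) • P - 1) = c • X → 2 • P - 1 = X := fun X hX =>
    smul_right_injective _ hc0 hX
  have h2inj : Function.Injective fun X : QubitOp => (2 : ℂ) • X :=
    smul_right_injective _ two_ne_zero
  rcases mul_self_eq_mul_self_iff.mp h2 with h | h
  · left
    have h4 := key (2 • Q - 1) (by rw [h1, h])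
    refine h2inj ?_
    change (2 : ℂ) • P = (2 : ℂ) • Q
    linear_combination (norm := module) h4
  · right
    have h4 := key (-(2 • Q - 1)) (by rw [h1, h]; module)
    refine h2inj ?_
    change (2 : ℂ) • P = (2 : ℂ) • (1 - Q)
    linear_combination (norm := module) h4

theorem IsPureProj.trace_conj_mul {P U : QubitOp} (hP : IsPureProj P) :
    (U * P * Uᴴ * P).trace = (U * P).trace * star (U * P).trace := by
  have h1 : (U * P * Uᴴ * P).trace = (P * U * P * Uᴴ).trace := by
    rw [trace_mul_comm, ← mul_assoc, ← mul_assoc]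
  rw [h1, hP.mul_mul, smul_mul_assoc, trace_smul, smul_eq_mul, ← trace_conjTranspose,
    conjTranspose_mul, hP.isHermitian.eq]

theorem trace_conj_mul_conj {U D : QubitOp} (hU : Uᴴ * U = 1) :
    ((U * D * Uᴴ) * (U * D * Uᴴ)).trace = (D * D).trace := by
  have : (U * D * Uᴴ) * (U * D * Uᴴ) = U * (D * D) * Uᴴ := by
    rw [show (U * D * Uᴴ) * (U * D * Uᴴ) = U * D * (Uᴴ * U) * D * Uᴴ by simp only [mul_assoc], hU]
    simp only [mul_assoc, mul_one]
  rw [this, trace_mul_comm, ← mul_assoc, hU, one_mul]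

/-- Equality case of Cauchy–Schwarz for `U` and `1`: the squared Hilbert–Schmidt norm of `U - t • 1`
is `2 - 2|t|²`. -/
theorem eq_smul_one_of_trace_eq {U : QubitOp} (hU : Uᴴ * U = 1) {t : ℂ} (htr : U.trace = 2 * t)
    (ht : t * star t = 1) : U = t • 1 := by
  refine sub_eq_zero.mp (trace_conjTranspose_mul_self_eq_zero_iff.mp
    (?_ : Matrix.trace ((U - t • (1 : QubitOp))ᴴ * (U - t • (1 : QubitOp))) = 0))
  have h1 : (U - t • (1 : QubitOp))ᴴ * (U - t • 1) =
      1 - t • Uᴴ - star t • U + (t * star t) • 1 := by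
    rw [conjTranspose_sub, conjTranspose_smul, conjTranspose_one, sub_mul, mul_sub, hU]
    simp only [mul_sub, smul_mul_assoc, mul_smul_comm, one_mul, mul_one]
    module
  rw [h1, trace_add, trace_sub, trace_sub, trace_smul, trace_smul, trace_smul,
    trace_conjTranspose, htr, ht]
  simp only [trace_one, Fintype.card_fin, smul_eq_mul, star_mul']
  have : star (2 : ℂ) = 2 := by simp
  rw [this]
  push_cast
  linear_combination (-4 : ℂ) * ht

/-! ### Rigidity under a nonscalar unitary -/

/-- Rank-one projectors resolving the identity and compatible with a common rotated dual operator
cannot include three distinct ones, unless the unitary is scalar. -/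
theorem eq_or_eq_or_eq_of_conj_sub_eq {ι : Type*} [Fintype ι] {U C : QubitOp} (hU : Uᴴ * U = 1)
    (hU0 : ∀ c : ℂ, U ≠ c • 1) {m a b : ι → ℝ} {P : ι → QubitOp} (hm : ∀ x, 0 < m x)
    (ha : ∀ x, 0 < a x) (hb : ∀ x, 0 ≤ b x) (hP : ∀ x, IsPureProj (P x))
    (hsum : ∑ x, (m x : ℂ) • P x = 1)
    (hC : ∀ x, (a x : ℂ) • (U * P x * Uᴴ) - (b x : ℂ) • P x = C) (x y z : ι) :
    P x = P y ∨ P y = P z ∨ P x = P z := by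
  have hU' : U * Uᴴ = 1 := mul_eq_one_comm.mp hU
  have htrC : ∀ w, ((a w - b w : ℝ) : ℂ) = C.trace := by
    intro w
    rw [← hC w, trace_sub, trace_smul, trace_smul, trace_mul_comm, ← mul_assoc, hU, one_mul,
      (hP w).trace_eq]
    simp
  have hconst : ∀ w, a w - b w = a x - b x := fun w => by
    exact_mod_cast (htrC w).trans (htrC x).symm
  by_cases hd : a x - b x = 0
  · have hcomm : ∀ w, Commute U (P w) := by
      have hC' : ∀ w, U * P w * Uᴴ - P w = ((a w)⁻¹ : ℂ) • C := by
        intro w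
        have hab : b w = a w := by linarith [hconst w]
        have hne : (a w : ℂ) ≠ 0 := Complex.ofReal_ne_zero.mpr (ha w).ne'
        rw [← hC w, hab, ← smul_sub, smul_smul, inv_mul_cancel₀ hne, one_smul]
      -- Weighting by `m w` sums the left sides to `U U† - 1 = 0`, while `C` acquires a positive
      -- coefficient.
      have h1 : ((∑ w, m w * (a w)⁻¹ : ℝ) : ℂ) • C = 0 := by
        have h2 : ∑ w, (m w : ℂ) • (U * P w * Uᴴ - P w) = 0 := by
          have h3 : ∀ w, (m w : ℂ) • (U * P w * Uᴴ - P w) =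
              U * ((m w : ℂ) • P w) * Uᴴ - (m w : ℂ) • P w := by
            intro w
            rw [mul_smul_comm, smul_mul_assoc, smul_sub]
          rw [Finset.sum_congr rfl fun w _ => h3 w, Finset.sum_sub_distrib, ← Finset.sum_mul,
            ← Finset.mul_sum, hsum, mul_one, hU', sub_self]
        rw [← h2]
        push_cast
        rw [Finset.sum_smul]
        exact Finset.sum_congr rfl fun w _ => by rw [hC', smul_smul]
      have hpos : 0 < ∑ w, m w * (a w)⁻¹ :=
        Finset.sum_pos (fun w _ => mul_pos (hm w) (inv_pos.mpr (ha w))) ⟨x, Finset.mem_univ x⟩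
      have hC0 : C = 0 :=
        (smul_eq_zero.mp h1).resolve_left (Complex.ofReal_ne_zero.mpr hpos.ne')
      intro w
      have h4 : U * P w * Uᴴ = P w := by
        have := hC' w
        rwa [hC0, smul_zero, sub_eq_zero] at this
      change U * P w = P w * U
      nth_rw 2 [← h4]
      rw [mul_assoc, hU, mul_one]
    have hor := fun v w => (hP v).eq_or_eq_one_sub (hP w) (hcomm v) (hcomm w) hU0
    rcases hor x y with h | h
    · exact Or.inl h
    rcases hor x z with h' | h'
    · exact Or.inr (Or.inr h')
    · exact Or.inr (Or.inl (sub_right_injective (h.symm.trans h')))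
  · left
    set t := (U * P x).trace with ht
    have htr : ∀ w, (U * P w).trace = t := by
      have h1 : ∀ w, ((a x - b x : ℝ) : ℂ) * (U * P w).trace = (C * U).trace := by
        intro w
        rw [← hC w, sub_mul, smul_mul_assoc, smul_mul_assoc, mul_assoc _ Uᴴ, hU, mul_one,
          trace_sub, trace_smul, trace_smul, trace_mul_comm (P w), ← hconst w]
        push_cast
        simp only [smul_eq_mul]
        ring
      intro w
      exact mul_left_cancel₀ (Complex.ofReal_ne_zero.mpr hd) ((h1 w).trans (h1 x).symm)
    have hm2 : ∑ w, (m w : ℂ) = 2 := by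
      have h1 := congrArg trace hsum
      simpa [trace_sum, trace_smul, (hP _).trace_eq] using h1
    have hUt : U.trace = 2 * t := by
      rw [← hm2, Finset.sum_mul]
      conv_lhs => rw [← mul_one U, ← hsum, Finset.mul_sum, trace_sum]
      exact Finset.sum_congr rfl fun w _ => by rw [mul_smul_comm, trace_smul, htr, smul_eq_mul]
    have ht1 : t * star t ≠ 1 := fun h => hU0 t (eq_smul_one_of_trace_eq hU hUt h)
    have htrCC : ∀ w, (C * C).trace = (a w : ℂ) ^ 2 + (b w : ℂ) ^ 2
        - 2 * a w * b w * (t * star t) := by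
      intro w
      have h1 := (hP w).trace_conj_mul (U := U)
      have h2 : (P w * (U * P w * Uᴴ)).trace = (U * P w * Uᴴ * P w).trace := trace_mul_comm _ _
      have h3 := trace_conj_mul_conj (D := P w) hU
      rw [htr] at h1
      rw [(hP w).mul_self, (hP w).trace_eq] at h3
      rw [← hC w]
      simp only [sub_mul, mul_sub, smul_mul_assoc, mul_smul_comm, trace_sub, trace_smul,
        smul_eq_mul, h3, h2, h1, (hP w).mul_self, (hP w).trace_eq]
      ring
    have hbb : b x = b y := by
      have h1 := (htrCC x).symm.trans (htrCC y)
      have hay : a y = a x - b x + b y := by linarith [hconst y]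
      rw [hay] at h1
      push_cast at h1
      -- `tr (C²) = d² + 2ab(1 - |t|²)` fixes the product `ab`; with `a - b` fixed, the difference
      -- of products factors like this.
      have h2 : (1 - t * star t) * (((b x - b y) * (a x + b y) : ℝ) : ℂ) = 0 := by
        push_cast
        linear_combination h1 / 2
      have h3 := (mul_eq_zero.mp h2).resolve_left (sub_ne_zero.mpr ht1.symm)
      rcases mul_eq_zero.mp (Complex.ofReal_eq_zero.mp h3) with h | h
      · linarith
      · linarith [ha x, hb y]
    have haa : a x = a y := by linarith [hconst y]
    have hD : (a x : ℂ) • (U * (P x - P y) * Uᴴ) = (b x : ℂ) • (P x - P y) := by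
      have h1 := (hC x).trans (hC y).symm
      rw [← hbb, ← haa] at h1
      rw [mul_sub, sub_mul, smul_sub, smul_sub]
      linear_combination (norm := module) h1
    have hDD : (((a x - b x) * (a x + b x) : ℝ) : ℂ) * ((P x - P y) * (P x - P y)).trace = 0 := by
      have h1 := congrArg (fun X => (X * X).trace) hD
      simp only [smul_mul_assoc, mul_smul_comm, trace_smul, smul_eq_mul,
        trace_conj_mul_conj hU] at h1
      push_cast
      linear_combination h1
    have hne : (a x - b x) * (a x + b x) ≠ 0 :=
      mul_ne_zero hd (by linarith [ha x, hb x])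
    have hH := (hP x).isHermitian.sub (hP y).isHermitian
    exact sub_eq_zero.mp (hH.eq_zero_of_trace_mul_self_eq_zero
      ((mul_eq_zero.mp hDD).resolve_left (Complex.ofReal_ne_zero.mpr hne)))

/-! ### Proof of the theorem -/

theorem QubitEnsemble.successProb_alwaysGuess {n : ℕ} (S : QubitEnsemble n) (j : Fin n) :
    S.successProb (QubitPOVM.alwaysGuess j) = S.q j := by
  rw [QubitEnsemble.successProb, Finset.sum_eq_single j]
  · simp [QubitPOVM.alwaysGuess, S.ρ_trace]
  · intro x _ hx
    simp [QubitPOVM.alwaysGuess, hx]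
  · simp

theorem conjugation_smul_one {U : QubitOp} (hU : Uᴴ * U = 1) {c : ℂ} (h : U = c • 1) :
    conjugation U = LinearMap.id := by
  have hc : c * star c = 1 := by
    have := congrFun (congrFun hU 0) 0
    rw [h] at this
    simpa [mul_comm] using this
  ext1 A
  change U * A * Uᴴ = A
  rw [h, conjTranspose_smul, conjTranspose_one, smul_mul_assoc, smul_mul_assoc, mul_smul_comm,
    smul_smul, hc, one_mul, mul_one, one_smul]

theorem not_linearIndependent_of_smul_eq {P Q R : QubitOp} {a b : ℂ} (ha : a ≠ 0)
    (hQ : Q = a • P) (hR : R = b • P) : ¬ LinearIndependent ℂ ![Q, R] := by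
  rw [LinearIndependent.pair_iff]
  intro h
  refine ha (neg_eq_zero.mp (h b (-a) ?_).2)
  rw [hQ, hR]
  module

theorem proposition5 {n : ℕ} (hn : 2 < n) (S : QubitEnsemble n)
    (hS : ∀ j : Fin n, ¬ S.IsOptimal (QubitPOVM.alwaysGuess j))
    (M : QubitPOVM n) (hM : S.IsOptimal M) (hid : M.IdentifiesAll)
    (hdir : ∃ x y z : Fin n,
      LinearIndependent ℂ ![M.elem x, M.elem y] ∧
      LinearIndependent ℂ ![M.elem y, M.elem z] ∧
      LinearIndependent ℂ ![M.elem x, M.elem z])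
    (U : Matrix.unitaryGroup (Fin 2) ℂ)
    (hU : (unitaryChannel U).toLin ≠ LinearMap.id) :
    ¬ (unitaryChannel U).IsOMP S M := by
  rintro ⟨-, hM'⟩
  obtain ⟨G, hG, hGM, hGtr⟩ := hM.exists_dual
  obtain ⟨G', hG', hGM', -⟩ := hM'.exists_dual
  have hUU : (U : QubitOp)ᴴ * (U : QubitOp) = 1 := Matrix.mem_unitaryGroup_iff'.mp U.2
  have hUU' : (U : QubitOp) * (U : QubitOp)ᴴ = 1 := Matrix.mem_unitaryGroup_iff.mp U.2
  -- A zero slack gives `tr G = q x`, so always guessing `x` would already be optimal.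
  have hA0 : ∀ x, G - (S.q x : ℂ) • S.ρ x ≠ 0 := by
    intro x hx
    refine hS x fun N => (hM N).trans ?_
    rw [S.successProb_alwaysGuess, ← hGtr, sub_eq_zero.mp hx, trace_smul, S.ρ_trace]
    simp
  have hdet : ∀ x, (M.elem x).det = 0 := by
    intro x
    have h := congrArg conjTranspose (hGM x)
    rw [conjTranspose_mul, (M.posSemidef x).1.eq, (hG x).1.eq, conjTranspose_zero] at h
    exact Matrix.det_eq_zero_of_mul_eq_zero_left h (hA0 x)
  choose P hP hMP using fun x => (M.posSemidef x).exists_isPureProj (hid x) (hdet x)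
  have hm : ∀ x, 0 < (M.elem x).trace.re := fun x => (M.posSemidef x).trace_re_pos (hid x)
  have hmne : ∀ x, ((M.elem x).trace.re : ℂ) ≠ 0 := fun x =>
    Complex.ofReal_ne_zero.mpr (hm x).ne'
  have hproj : ∀ {A : QubitOp} x, A * M.elem x = 0 → A * P x = 0 := by
    intro A x h
    rw [hMP x, mul_smul_comm] at h
    exact (smul_eq_zero.mp h).resolve_left (hmne x)
  have hA := fun x => (hP x).eq_smul_one_sub (hG x) (hproj x (hGM x))
  have hB := fun x => (hP x).eq_smul_one_sub (hG' x) (hproj x (hGM' x))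
  set a : Fin n → ℝ := fun x => (G - (S.q x : ℂ) • S.ρ x).trace.re with ha
  set b : Fin n → ℝ := fun x =>
    (G' - (((S.through (unitaryChannel U)).q x : ℝ) : ℂ) •
      (S.through (unitaryChannel U)).ρ x).trace.re with hb
  have hapos : ∀ x, 0 < a x := fun x => (hG x).trace_re_pos (hA0 x)
  have hbnn : ∀ x, 0 ≤ b x := fun x => (hG' x).trace_re_nonneg
  set D : QubitOp := (U : QubitOp) * G * (U : QubitOp)ᴴ - G' with hD
  -- The terms `q x • U ρ x U†` cancel, leaving `U G U† - G'`.
  have hdiff : ∀ x, (a x : ℂ) • (1 - (U : QubitOp) * P x * (U : QubitOp)ᴴ) -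
      (b x : ℂ) • (1 - P x) = D := by
    intro x
    have h1 : (U : QubitOp) * ((a x : ℂ) • (1 - P x)) * (U : QubitOp)ᴴ =
        (a x : ℂ) • (1 - (U : QubitOp) * P x * (U : QubitOp)ᴴ) := by
      rw [mul_smul_comm, smul_mul_assoc, mul_sub, sub_mul, mul_one, hUU']
    rw [← h1, ← hA x, ← hB x]
    change (U : QubitOp) * (G - (S.q x : ℂ) • S.ρ x) * (U : QubitOp)ᴴ -
      (G' - (S.q x : ℂ) • ((U : QubitOp) * S.ρ x * (U : QubitOp)ᴴ)) = D
    rw [mul_sub, sub_mul, mul_smul_comm, smul_mul_assoc, hD]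
    abel
  have hab : ∀ x, ((a x - b x : ℝ) : ℂ) = D.trace := by
    intro x
    rw [← hdiff x, trace_sub, trace_smul, trace_smul, trace_sub, trace_sub, trace_mul_comm,
      ← mul_assoc, hUU, one_mul, (hP x).trace_eq]
    simp
    norm_num
  have hscalar : ∀ c : ℂ, (U : QubitOp) ≠ c • 1 := fun c hc =>
    hU (conjugation_smul_one hUU hc)
  have hsum : ∑ x, ((M.elem x).trace.re : ℂ) • P x = 1 := by
    rw [← M.sum_eq_one]
    exact Finset.sum_congr rfl fun x _ => (hMP x).symm
  have hC : ∀ x, (a x : ℂ) • ((U : QubitOp) * P x * (U : QubitOp)ᴴ) - (b x : ℂ) • P x =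
      D.trace • 1 - D := by
    intro x
    nth_rw 2 [← hdiff x]
    rw [← hab x]
    push_cast
    module
  obtain ⟨x, y, z, hxy, hyz, hxz⟩ := hdir
  have hne : ∀ {v w}, LinearIndependent ℂ ![M.elem v, M.elem w] → P v ≠ P w := by
    intro v w h hvw
    exact not_linearIndependent_of_smul_eq (hmne v) (hMP v) (hvw ▸ hMP w) h
  rcases eq_or_eq_or_eq_of_conj_sub_eq hUU hscalar hm hapos hbnn hP hsum hC x y z with h | h | h
  · exact hne hxy h
  · exact hne hyz h
  · exact hne hxz h
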